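/- Let $n\ge 1$. Let $\mathscr L_\bullet$ be the group algebra over $\mathbb Q$ of the free group on $2n+1$ generators $X_1,\dots,X_n,Y_1,\dots,Y_n,Z$, regarded as a subalgebra of the free skew field $\mathcal F$ over $\mathbb Q$ on these generators. Extend the indices to $\mathbb Z$ by $X_{k+n}=ZX_kZ^{-1}$, $Y_{k+n}=ZY_kZ^{-1}$, and put $\sigma_k=X_k+Y_k$. The (noncommutative form of the) Grassmann pentagram map $T$ is the substitution $$T(X_k)=\sigma_k^{-1}X_k\,\sigma_{k+2},\qquad T(Y_k)=\sigma_{k+1}^{-1}Y_{k+1}\,\sigma_{k+3},\qquad T(Z)=Z,$$ and the shifted map is $\widehat T=S^2\circ T$, where $S(X_k)=X_{k-1}$, $S(Y_k)=Y_{k-1}$, $S(Z)=Z$ (indices extended as above, so $X_0=Z^{-1}X_nZ$). Let $Q_n$ be the following acyclic network on the annulus. It has sources $1,2,3$, sinks $1,2,3$ and $n$ square faces. The $m$-th square has corners $TL_m,TR_m,BL_m,BR_m$ and arrows $BL_m\to TL_m$ of weight $X_m$, $BL_m\to BR_m$ of weight $Y_m$, and $TL_m\to TR_m$, $TR_m\to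 BR_m$ of weight $1$. There are further arrows $BR_m\to TL_{m+1}$, $TR_m\to BL_{m+2}$, and from the sources $1,2,3$ to $TL_1$, $BL_1$, $BL_2$ respectively, where $TL_{n+1},BL_{n+1},BL_{n+2}$ mean the sinks $1,2,3$; these arrows have weight $Z$ if they end at a sink and weight $1$ otherwise. Each arrow weight is multiplied by $\lambda^{c}$, where $\lambda$ is a central variable and $c$ is the signed number of crossings of the arrow with the cut: $c=c'+c''$, with $c'=1$ for $BR_{m-1}\to TL_m$ with $m\le n$ and $3\mid m$, $c'=-1$ for the arrow leaving $TR_m$ to the right (to $BL_{m+2}$) with $3\mid m$, and $c'=0$ otherwise; and $c''=1$ if the arrow ends at sink $k$ with $k\le (2n \bmod 3)$, $c''=0$ otherwise. Let $\mathscr B=\mathscr B(\lambda)$ be the $3\times 3$ boundary measurement matrix, whose $(a,b)$ entry in $\mathscr L_\bullet[\lambda^{\pm1}]$ is the sum over all directed paths from source $a$ to sink $b$ of the product, from left to right, of the modified arrow weights. Write $$\operatorname{tr}(\mathscr B^i)=\sum_j t_{ij}\lambda^j,\qquad t_{ij}\in\mathscr L_\bullet .$$ For an associative $\mathbb Q$-algebra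 $A$ let $[A,A]$ be the linear span of all commutators, $A^\natural=A/[A,A]$, and let $a^\natural$ be the class of $a\in A$. **Theorem.** For all integers $i\ge 0$ and $j$, the class $t_{ij}^\natural$ is invariant under both $T$ and $\widehat T$: in $\mathcal F^\natural$, $$T(t_{ij})^\natural=t_{ij}^\natural\qquad\text{and}\qquad \widehat T(t_{ij})^\natural=t_{ij}^\natural .$$ More generally, the same two equalities hold in $R^\natural$ for every associative unital $\mathbb Q$-algebra $R$ and every choice of invertible elements $X_1,\dots,X_n,Y_1,\dots,Y_n,Z$ of $R$ (for instance matrices) such that all $X_k+Y_k$ are invertible, where $T$ and $\widehat T$ act on such tuples by the formulas above and the $t_{ij}$ are evaluated at the tuples. -/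

import Mathlib

open scoped LaurentPolynomial

namespace GrassmannPentagram

/-! ### The cyclic space of an associative algebra -/

/-- The linear span `[A, A]` of all commutators (a subspace, in general not an ideal). -/
def commutatorSpan (A : Type*) [Ring A] [Algebra ℚ A] : Submodule ℚ A :=
  Submodule.span ℚ {c : A | ∃ a b : A, c = a * b - b * a}

/-- The cyclic space `A / [A, A]`. -/
abbrev CyclicSpace (A : Type*) [Ring A] [Algebra ℚ A] : Type _ :=
  A ⧸ commutatorSpan A

/-- The class of an element of `A` in the cyclic space. -/
def cyc {A : Type*} [Ring A] [Algebra ℚ A] (a : A) : CyclicSpace A :=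
  (commutatorSpan A).mkQ a

/-! ### The free skew field -/

/-- A square matrix of size `m` is full if it is not a product of an `m × r` matrix and an
`r × m` matrix with `r < m`. -/
def IsFull {R : Type*} [Ring R] {m : ℕ} (A : Matrix (Fin m) (Fin m) R) : Prop :=
  ∀ (r : ℕ) (P : Matrix (Fin m) (Fin r) R) (Q : Matrix (Fin r) (Fin m) R), A = P * Q → m ≤ r

/-- The full square matrices over the free algebra `ℚ⟨ι⟩`. -/
structure FullMatrix (ι : Type) where
  size : ℕ
  mat : Matrix (Fin size) (Fin size) (FreeAlgebra ℚ ι)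
  isFull : IsFull mat

/-- Generators of the free skew field: the variables, and for each full matrix the entries of
its formal inverse. -/
inductive SkewGen (ι : Type) where
  | var (x : ι)
  | invEntry (A : FullMatrix ι) (i j : Fin A.size)

/-- The matrix of formal inverse entries of a full matrix. -/
def formalInv {ι : Type} (A : FullMatrix ι) :
    Matrix (Fin A.size) (Fin A.size) (FreeAlgebra ℚ (SkewGen ι)) :=
  Matrix.of fun i j => FreeAlgebra.ι ℚ (SkewGen.invEntry A i j)

/-- A full matrix, with its entries read in the larger free algebra. -/
def liftMat {ι : Type} (A : FullMatrix ι) :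
    Matrix (Fin A.size) (Fin A.size) (FreeAlgebra ℚ (SkewGen ι)) :=
  A.mat.map (FreeAlgebra.lift ℚ fun x : ι => FreeAlgebra.ι ℚ (SkewGen.var x))

/-- The relations `A A⁻¹ = 1` and `A⁻¹ A = 1` for all full matrices `A`, entry by entry. -/
inductive SkewRel (ι : Type) :
    FreeAlgebra ℚ (SkewGen ι) → FreeAlgebra ℚ (SkewGen ι) → Prop
  | mul_inv (A : FullMatrix ι) (i j : Fin A.size) :
      SkewRel ι ((liftMat A * formalInv A) i j)
        ((1 : Matrix (Fin A.size) (Fin A.size) (FreeAlgebra ℚ (SkewGen ι))) i j)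
  | inv_mul (A : FullMatrix ι) (i j : Fin A.size) :
      SkewRel ι ((formalInv A * liftMat A) i j)
        ((1 : Matrix (Fin A.size) (Fin A.size) (FreeAlgebra ℚ (SkewGen ι))) i j)

/-- The free skew field `F(ι)` over `ℚ`, in Cohn's construction: the free algebra `ℚ⟨ι⟩` with
an inverse adjoined to every full matrix. This is the universal field of fractions of
`ℚ⟨ι⟩`. -/
abbrev FreeSkewField (ι : Type) : Type := RingQuot (SkewRel ι)

/-- The canonical homomorphism `ℚ⟨ι⟩ → F(ι)`. -/
noncomputable def toSkew (ι : Type) : FreeAlgebra ℚ ι →ₐ[ℚ] FreeSkewField ι :=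
  (RingQuot.mkAlgHom ℚ (SkewRel ι)).comp
    (FreeAlgebra.lift ℚ fun x : ι => FreeAlgebra.ι ℚ (SkewGen.var x))

/-- A nonzero element of `ℚ⟨ι⟩` is a full `1 × 1` matrix, so it is invertible in `F(ι)`. -/
theorem isUnit_toSkew {ι : Type} {a : FreeAlgebra ℚ ι} (ha : a ≠ 0) :
    IsUnit (toSkew ι a) := by
  have hfull : IsFull (Matrix.of fun _ _ : Fin 1 => a) := by
    intro r P Q h
    by_contra hr
    have hr0 : r = 0 := by omega
    subst hr0
    apply ha
    have := congrFun (congrFun h 0) 0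
    simpa [Matrix.mul_apply] using this
  let A : FullMatrix ι := ⟨1, _, hfull⟩
  have h1 := RingQuot.mkAlgHom_rel ℚ (SkewRel.mul_inv A 0 0)
  have h2 := RingQuot.mkAlgHom_rel ℚ (SkewRel.inv_mul A 0 0)
  have e1 : (liftMat A * formalInv A) 0 0 =
      FreeAlgebra.lift ℚ (fun x : ι => FreeAlgebra.ι ℚ (SkewGen.var x)) a *
        FreeAlgebra.ι ℚ (SkewGen.invEntry A 0 0) := by
    rw [Matrix.mul_apply]
    exact Fin.sum_univ_one _
  have e2 : (formalInv A * liftMat A) 0 0 =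
      FreeAlgebra.ι ℚ (SkewGen.invEntry A 0 0) *
        FreeAlgebra.lift ℚ (fun x : ι => FreeAlgebra.ι ℚ (SkewGen.var x)) a := by
    rw [Matrix.mul_apply]
    exact Fin.sum_univ_one _
  rw [e1, Matrix.one_apply_eq, map_mul, map_one] at h1
  rw [e2, Matrix.one_apply_eq, map_mul, map_one] at h2
  exact ⟨⟨_, _, h1, h2⟩, rfl⟩

/-! ### The algebra of based loops -/

/-- The `2n + 1` variables `X_1, …, X_n, Y_1, …, Y_n, Z`. The element `i : Fin n` stands for
the index `i + 1`. -/
inductive Gen (n : ℕ) where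
  | X (i : Fin n)
  | Y (i : Fin n)
  | Z

/-- The algebra of based loops: the group algebra over `ℚ` of the free group on the
`X_i`, `Y_i` and `Z`. -/
abbrev LoopAlg (n : ℕ) : Type := MonoidAlgebra ℚ (FreeGroup (Gen n))

/-- A variable as an element of the algebra of based loops. -/
noncomputable def loop {n : ℕ} (g : Gen n) : LoopAlg n :=
  MonoidAlgebra.of ℚ (FreeGroup (Gen n)) (FreeGroup.of g)

/-! ### The network on the annulus -/

/-- Vertices of the network: three sources, the four corners of each of the `n` square faces,
three sinks. Sources and sinks `0, 1, 2` are those with the labels `1, 2, 3`. -/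
inductive Vertex (n : ℕ) where
  | source (k : Fin 3)
  | topLeft (i : Fin n)
  | topRight (i : Fin n)
  | botLeft (i : Fin n)
  | botRight (i : Fin n)
  | sink (k : Fin 3)

/-- The upper left corner of square `k` (counted from `0`); beyond the last square this is
the sink that is glued to the source in front of the upper left corner of square `0`. -/
def topPort (n k : ℕ) : Vertex n :=
  if h : k < n then .topLeft ⟨k, h⟩ else .sink 0

/-- The lower left corner of square `k` (counted from `0`); beyond the last square these are
the sinks that are glued to the sources in front of the lower left corners of
squares `0` and `1`. -/
def botPort (n k : ℕ) : Vertex n :=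
  if h : k < n then .botLeft ⟨k, h⟩ else if k = n then .sink 1 else .sink 2

/-- Arrows of the network. -/
inductive Arrow (n : ℕ) where
  | entry (k : Fin 3)
  | left (i : Fin n)
  | top (i : Fin n)
  | bottom (i : Fin n)
  | right (i : Fin n)
  | down (i : Fin n)
  | skip (i : Fin n)

/-- The source of an arrow. -/
def Arrow.src {n : ℕ} : Arrow n → Vertex n
  | .entry k => .source k
  | .left i => .botLeft i
  | .top i => .topLeft i
  | .bottom i => .botLeft i
  | .right i => .topRight i
  | .down i => .botRight i
  | .skip i => .topRight i

/-- The target of an arrow. The lower right corner of each square is joined to the upper left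
corner of the next one, the upper right corner to the lower left corner of the second next. -/
def Arrow.tgt {n : ℕ} : Arrow n → Vertex n
  | .entry k => if k = 0 then topPort n 0 else if k = 1 then botPort n 0 else botPort n 1
  | .left i => .topLeft i
  | .top i => .topRight i
  | .bottom i => .botRight i
  | .right i => .botRight i
  | .down i => topPort n (i + 1)
  | .skip i => botPort n (i + 2)

instance (n : ℕ) : Quiver (Vertex n) :=
  ⟨fun a b => {e : Arrow n // e.src = a ∧ e.tgt = b}⟩

/-- The weight on an arrow before the modification by the cut: `X_i` on the left and `Y_i` on
the bottom of the squares, `Z` on the three arrows into the sinks, `1` elsewhere. -/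
noncomputable def Arrow.weight {n : ℕ} (e : Arrow n) : LoopAlg n :=
  (match e with
    | .left i => loop (.X i)
    | .bottom i => loop (.Y i)
    | _ => 1) *
  (match e.tgt with
    | .sink _ => loop .Z
    | _ => 1)

/-- Signed number of crossings of an arrow with the cut, downwards counted as `+1`.
The annulus is a rectangle whose top and bottom edges are glued, the glued edge being the cut.
There are three levels; the top of the square with number `m = 1, …, n` lies on the levels
`3, 2, 1, 3, 2, 1, …`. So the arrow into the upper left corner of square `m` from square
`m - 1` crosses the cut downwards when `3 ∣ m`, and the arrow leaving the upper right corner of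
square `m` crosses it upwards when `3 ∣ m`. Then the three outgoing arrows lie on the three
levels in a cyclic order that depends on `n` modulo `3`, and in a collar of the right boundary
they turn downwards until the sinks `1, 2, 3` are on the levels `3, 2, 1`, as the sources are,
so that the cut closes up on the torus: for `n ≡ 0, 1, 2` modulo `3` the arrows that cross the
cut in the collar are those into no sink, into the sinks `1` and `2`, into the sink `1`. -/
def Arrow.crossing {n : ℕ} (e : Arrow n) : ℤ :=
  (match e with
    | .down i => if 3 ∣ (i : ℕ) + 2 ∧ (i : ℕ) + 1 < n then 1 else 0
    | .skip i => if 3 ∣ (i : ℕ) + 1 then -1 else 0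
    | _ => 0) +
  (match e.tgt with
    | .sink k => if (k : ℕ) < 2 * n % 3 then 1 else 0
    | _ => 0)

/-- The modified weight of an arrow, a Laurent monomial in the central variable `λ`. -/
noncomputable def Arrow.modifiedWeight {n : ℕ} (e : Arrow n) : (LoopAlg n)[T;T⁻¹] :=
  LaurentPolynomial.C e.weight * LaurentPolynomial.T e.crossing

/-- A height that increases along every arrow. -/
def Vertex.rank {n : ℕ} : Vertex n → ℕ
  | .source _ => 0
  | .botLeft i => 4 * i + 1
  | .topLeft i => 4 * i + 2
  | .topRight i => 4 * i + 3
  | .botRight i => 4 * i + 4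
  | .sink _ => 4 * n + 5

theorem Arrow.rank_lt {n : ℕ} (e : Arrow n) : e.src.rank < e.tgt.rank := by
  cases e with
  | entry k =>
    simp only [Arrow.src, Arrow.tgt, topPort, botPort]
    split_ifs <;> simp [Vertex.rank]
  | down i =>
    have := i.2
    simp only [Arrow.src, Arrow.tgt, topPort]
    split_ifs <;> simp only [Vertex.rank] <;> omega
  | skip i =>
    have := i.2
    simp only [Arrow.src, Arrow.tgt, botPort]
    split_ifs <;> simp only [Vertex.rank] <;> omega
  | _ => simp [Arrow.src, Arrow.tgt, Vertex.rank]

instance (n : ℕ) : Finite (Arrow n) := by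
  let f : Arrow n → Fin 7 × (Fin 3 ⊕ Fin n) := fun e => match e with
    | .entry k => (0, .inl k)
    | .left i => (1, .inr i)
    | .top i => (2, .inr i)
    | .bottom i => (3, .inr i)
    | .right i => (4, .inr i)
    | .down i => (5, .inr i)
    | .skip i => (6, .inr i)
  refine Finite.of_injective f ?_
  intro a b h
  cases a <;> cases b <;> simp_all [f]

/-- The network is acyclic, so there are finitely many paths between two vertices. -/
instance finite_path {n : ℕ} (a b : Vertex n) : Finite (Quiver.Path a b) := by
  induction hr : b.rank using Nat.strong_induction_on generalizing b with
  | _ r ih =>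
    have : ∀ e : {e : Arrow n // e.tgt = b}, Finite (Quiver.Path a e.1.src) := fun e =>
      ih _ (by have := e.1.rank_lt; rw [e.2] at this; omega) _ rfl
    let f : Option (Σ e : {e : Arrow n // e.tgt = b}, Quiver.Path a e.1.src) →
        Set (Quiver.Path a b) := fun o => match o with
      | none => {p | p.length = 0}
      | some ⟨e, p⟩ => {p.cons (⟨e.1, rfl, e.2⟩ : e.1.src ⟶ b)}
    have hf : ∀ o, (f o).Finite := by
      intro o
      match o with
      | none =>
        refine Set.Subsingleton.finite ?_
        intro p hp q hq
        cases p with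
        | nil => cases q with
          | nil => rfl
          | cons q e => simp [f] at hq
        | cons p e => simp [f] at hp
      | some ⟨e, p⟩ => exact Set.finite_singleton _
    have hU : (⋃ o, f o) = Set.univ := by
      refine Set.eq_univ_of_forall fun p => Set.mem_iUnion.2 ?_
      cases p with
      | nil => exact ⟨none, rfl⟩
      | cons p e =>
        obtain ⟨e, rfl, he⟩ := e
        exact ⟨some ⟨⟨e, he⟩, p⟩, rfl⟩
    exact Set.finite_univ_iff.1 (hU ▸ Set.finite_iUnion hf)

/-- The boundary measurement matrix: the `(a, b)` entry is the sum, over all paths from source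
`a` to sink `b`, of the product of the modified weights along the path, from left to right. -/
noncomputable def boundaryMatrix (n : ℕ) : Matrix (Fin 3) (Fin 3) (LoopAlg n)[T;T⁻¹] :=
  Matrix.of fun a b =>
    ∑ᶠ p : Quiver.Path (Vertex.source a : Vertex n) (Vertex.sink b),
      p.weight fun {a b} (e : {e : Arrow n // e.src = a ∧ e.tgt = b}) => e.1.modifiedWeight

/-- The coefficient of `λ ^ j` in the trace of the `i`-th power of the boundary measurement
matrix. -/
noncomputable def invariantCoeff (n i : ℕ) (j : ℤ) : LoopAlg n :=
  (Matrix.trace (boundaryMatrix n ^ i)).coeff j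

/-! ### The pentagram map -/

section Map

variable {n : ℕ} [NeZero n] {R : Type*} [Ring R]

/-- The extension of the variables `X_i` to all `i : ℤ` by `X_{i+n} = Z X_i Z⁻¹`. -/
def extX (u : Gen n → Rˣ) (k : ℤ) : Rˣ :=
  u .Z ^ (k / n) * u (.X (Fin.ofNat n (k % n).toNat)) * (u .Z ^ (k / n))⁻¹

/-- The extension of the variables `Y_i` to all `i : ℤ` by `Y_{i+n} = Z Y_i Z⁻¹`. -/
def extY (u : Gen n → Rˣ) (k : ℤ) : Rˣ :=
  u .Z ^ (k / n) * u (.Y (Fin.ofNat n (k % n).toNat)) * (u .Z ^ (k / n))⁻¹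

/-- `σ_i = X_i + Y_i`. -/
def sigma (u : Gen n → Rˣ) (k : ℤ) : R := (extX u k : R) + (extY u k : R)

/-- The condition under which the pentagram map is defined: all `X_i + Y_i` are invertible. -/
def IsGeneric (u : Gen n → Rˣ) : Prop :=
  ∀ i : Fin n, IsUnit ((u (.X i) : R) + (u (.Y i) : R))

theorem IsGeneric.isUnit_sigma {u : Gen n → Rˣ} (hu : IsGeneric u) (k : ℤ) :
    IsUnit (sigma u k) := by
  have h : sigma u k = ((u .Z ^ (k / n) : Rˣ) : R) *
      ((u (.X (Fin.ofNat n (k % n).toNat)) : R) + (u (.Y (Fin.ofNat n (k % n).toNat)) : R)) *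
      (((u .Z ^ (k / n))⁻¹ : Rˣ) : R) := by
    simp only [sigma, extX, extY, Units.val_mul]
    noncomm_ring
  rw [h]
  exact ((Units.isUnit _).mul (hu _)).mul (Units.isUnit _)

/-- `σ_i` as an invertible element. -/
noncomputable def sigmaUnit {u : Gen n → Rˣ} (hu : IsGeneric u) (k : ℤ) : Rˣ :=
  (hu.isUnit_sigma k).unit

/-- The pentagram map `T`:
`X_i ↦ σ_i⁻¹ X_i σ_{i+2}`, `Y_i ↦ σ_{i+1}⁻¹ Y_{i+1} σ_{i+3}`, `Z ↦ Z`. -/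
noncomputable def pentagram (u : Gen n → Rˣ) (hu : IsGeneric u) : Gen n → Rˣ
  | .X i => (sigmaUnit hu (i : ℕ))⁻¹ * extX u (i : ℕ) * sigmaUnit hu ((i : ℕ) + 2)
  | .Y i => (sigmaUnit hu ((i : ℕ) + 1))⁻¹ * extY u ((i : ℕ) + 1) * sigmaUnit hu ((i : ℕ) + 3)
  | .Z => u .Z

/-- The shift of indices `S`: `X_i ↦ X_{i-1}`, `Y_i ↦ Y_{i-1}`, `Z ↦ Z`. -/
def shift (u : Gen n → Rˣ) : Gen n → Rˣ
  | .X i => extX u ((i : ℕ) - 1)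
  | .Y i => extY u ((i : ℕ) - 1)
  | .Z => u .Z

/-- The shifted pentagram map `T` followed by the shift of indices by two. -/
noncomputable def shiftedPentagram (u : Gen n → Rˣ) (hu : IsGeneric u) : Gen n → Rˣ :=
  shift (shift (pentagram u hu))

end Map

/-- The homomorphism from the algebra of based loops that sends each variable `g` to the
invertible element `u g`. -/
noncomputable def evalAt {n : ℕ} {R : Type*} [Ring R] [Algebra ℚ R] (u : Gen n → Rˣ) :
    LoopAlg n →ₐ[ℚ] R :=
  MonoidAlgebra.lift ℚ R (FreeGroup (Gen n)) ((Units.coeHom R).comp (FreeGroup.lift u))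

/-! ### The variables in the free skew field -/

theorem var_ne_zero {n : ℕ} (g : Gen n) : FreeAlgebra.ι ℚ g ≠ 0 := by
  intro h
  have := congrArg (FreeAlgebra.lift ℚ fun _ : Gen n => (1 : ℚ)) h
  simp at this

theorem var_add_var_ne_zero {n : ℕ} (g h : Gen n) :
    FreeAlgebra.ι ℚ g + FreeAlgebra.ι ℚ h ≠ 0 := by
  intro e
  have := congrArg (FreeAlgebra.lift ℚ fun _ : Gen n => (1 : ℚ)) e
  norm_num at this

/-- The variables as invertible elements of the free skew field `F(X_i, Y_i, Z)`. -/
noncomputable def skewVar (n : ℕ) (g : Gen n) : (FreeSkewField (Gen n))ˣ :=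
  (isUnit_toSkew (var_ne_zero g)).unit

theorem skewVar_isGeneric (n : ℕ) [NeZero n] : IsGeneric (skewVar n) := by
  intro i
  have h := isUnit_toSkew (var_add_var_ne_zero (Gen.X i) (Gen.Y i))
  rw [map_add] at h
  exact h

end GrassmannPentagram

open GrassmannPentagram

namespace GrassmannPentagram

/-! ### Traces of matrices over Laurent polynomials modulo commutators -/

section Cyclic

variable {R : Type*} [Ring R] [Algebra ℚ R]

/-! A path meets each cut between consecutive squares at one of three ports, so path sums are
entries of products of 3×3 matrices, with one factor L_k (`transfer`) per square. The crossings
recorded by λ depend on k modulo 3. Rescaling the ports by powers of λ (`portFactor`) removes this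
dependence, and what remains at the three sinks is one common factor ζ = Z λ^⌊(n+2)/3⌋. Counting
squares from 0, this gives B = L_0 ⋯ L_{n-1} ζ (`boundaryMatrix_eq`). The rule X_{k+n} = Z X_k Z⁻¹,
and likewise for Y, becomes L_{k+n} ζ = ζ L_k (`extTransfer_add_mul`).

The trace of a matrix product over a noncommutative ring is cyclic up to commutators of entries.
Hence the classes of the λ-coefficients of tr(M^i) do not change when M is conjugated by an
invertible matrix (`cyc_coeff_trace_pow_eq_of_mul_eq`), nor when the monodromy M_s = L_s ⋯ L_{s+n-1}
ζ starts at another square (`cyc_monodromy_succ`). The latter settles the shift S.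

For T, let L'_k be the matrices of the image. There are explicit invertible P_k with L'_k P_{k+1} =
P_k L_{k+2} (`extTransfer_pentagram_mul`) and P_{k+n} ζ = ζ P_k. Telescoping gives M'_0 P_0 = P_0
M_2, so M'_0 is conjugate to M_2, and M_2 has the same trace classes as M_0. The argument uses only
that the variables and the σ_k are invertible, so the free skew field is a special case. -/

theorem coeff_mul_sub_mem_commutatorSpan (f g : R[T;T⁻¹]) (j : ℤ) :
    (f * g - g * f).coeff j ∈ commutatorSpan R := by
  induction f using LaurentPolynomial.induction_on' with
  | add p q hp hq =>
    have h : (p + q) * g - g * (p + q) = (p * g - g * p) + (q * g - g * q) := by noncomm_ring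
    rw [h, AddMonoidAlgebra.coeff_add]
    exact Submodule.add_mem _ hp hq
  | C_mul_T k a =>
    induction g using LaurentPolynomial.induction_on' with
    | add p q hp hq =>
      have h (f : R[T;T⁻¹]) : f * (p + q) - (p + q) * f = (f * p - p * f) + (f * q - q * f) := by
        noncomm_ring
      rw [h, AddMonoidAlgebra.coeff_add]
      exact Submodule.add_mem _ hp hq
    | C_mul_T l b =>
      -- Since λ is central, the commutator of a λ^k and b λ^l is (ab - ba) λ^(k+l).
      simp only [← LaurentPolynomial.single_eq_C_mul_T, AddMonoidAlgebra.single_mul_single,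
        add_comm l k, ← AddMonoidAlgebra.single_sub]
      rw [AddMonoidAlgebra.coeff_single, Finsupp.single_apply]
      split_ifs
      · exact Submodule.subset_span ⟨a, b, rfl⟩
      · exact Submodule.zero_mem _

variable {m : Type*} [Fintype m]

/-- The two traces differ by the sum of the commutators of A a b with B b a, and each λ-coefficient
of such a commutator lies in the commutator span of R. -/
theorem cyc_coeff_trace_mul_comm (A B : Matrix m m R[T;T⁻¹]) (j : ℤ) :
    cyc ((A * B).trace.coeff j) = cyc ((B * A).trace.coeff j) := by
  refine (Submodule.Quotient.eq _).2 ?_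
  have h : (A * B).trace - (B * A).trace = ∑ a, ∑ b, (A a b * B b a - B b a * A a b) := by
    simp only [Matrix.trace, Matrix.diag, Matrix.mul_apply, Finset.sum_sub_distrib]
    congr 1
    exact Finset.sum_comm
  have h' (j : ℤ) : (A * B).trace.coeff j - (B * A).trace.coeff j
      = ∑ a, ∑ b, (A a b * B b a - B b a * A a b).coeff j := by
    rw [← Finsupp.sub_apply, ← AddMonoidAlgebra.coeff_sub, h]
    simp [AddMonoidAlgebra.coeff_sum]
  rw [h']
  exact Submodule.sum_mem _ fun a _ => Submodule.sum_mem _ fun b _ =>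
    coeff_mul_sub_mem_commutatorSpan _ _ _

variable [DecidableEq m]

theorem cyc_coeff_trace_pow_mul_comm (A B : Matrix m m R[T;T⁻¹]) (i : ℕ) (j : ℤ) :
    cyc (((A * B) ^ i).trace.coeff j) = cyc (((B * A) ^ i).trace.coeff j) := by
  cases i with
  | zero => simp
  | succ i =>
    -- Isolating one factor A lets a single cyclic rotation turn (AB)^(i+1) into (BA)^(i+1).
    have h : (A * B) ^ (i + 1) = A * ((B * A) ^ i * B) := by
      induction i with
      | zero => simp
      | succ i ih => rw [pow_succ, ih, pow_succ]; simp only [mul_assoc]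
    rw [h, cyc_coeff_trace_mul_comm, mul_assoc, ← pow_succ]

theorem cyc_coeff_trace_pow_eq_of_mul_eq {M N P Q : Matrix m m R[T;T⁻¹]} (h : M * P = P * N)
    (hPQ : P * Q = 1) (hQP : Q * P = 1) (i : ℕ) (j : ℤ) :
    cyc ((M ^ i).trace.coeff j) = cyc ((N ^ i).trace.coeff j) := by
  have h₁ : M = P * (N * Q) := by rw [← mul_assoc, ← h, mul_assoc, hPQ, mul_one]
  have h₂ : N = N * Q * P := by rw [mul_assoc, hQP, mul_one]
  rw [h₁, cyc_coeff_trace_pow_mul_comm, ← h₂]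

end Cyclic

/-! ### The transfer matrices of the squares -/

section Transfer

variable {R : Type*} [Ring R]

/-- The transfer matrix of a square with left weight `x` and bottom weight `y`, acting on the
upper line and on the two lower lines. -/
noncomputable def transfer (x y : R) : Matrix (Fin 3) (Fin 3) R[T;T⁻¹] :=
  !![1, 0, .T (-1); .C (x + y), 0, .C x * .T (-1); 0, 1, 0]

/-- The product of the first `m` matrices of a sequence. -/
def seqProd {M : Type*} [Monoid M] (f : ℕ → M) (m : ℕ) : M :=
  ((List.range m).map f).prod

theorem seqProd_zero {M : Type*} [Monoid M] (f : ℕ → M) : seqProd f 0 = 1 := rfl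

theorem seqProd_succ {M : Type*} [Monoid M] (f : ℕ → M) (m : ℕ) :
    seqProd f (m + 1) = seqProd f m * f m :=
  List.prod_range_succ f m

theorem seqProd_succ' {M : Type*} [Monoid M] (f : ℕ → M) (m : ℕ) :
    seqProd f (m + 1) = f 0 * seqProd (fun k => f (k + 1)) m :=
  List.prod_range_succ' f m

/-- Telescoping: the intertwiner p passes through the product one factor at a time. -/
theorem seqProd_mul_eq {M : Type*} [Monoid M] {f g p : ℕ → M}
    (h : ∀ k, f k * p (k + 1) = p k * g k) (m : ℕ) :
    seqProd f m * p m = p 0 * seqProd g m := by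
  induction m with
  | zero => simp [seqProd_zero]
  | succ m ih => rw [seqProd_succ, seqProd_succ, mul_assoc, h, ← mul_assoc, ih, mul_assoc]

/-- The factor at the end of the network, for a network of `n` squares. -/
noncomputable def endFactor (n : ℕ) (z : R) : R[T;T⁻¹] :=
  .C z * .T (((n + 2) / 3 : ℕ) : ℤ)

variable {n : ℕ} [NeZero n]

/-- The transfer matrix of square `k`, with the indices extended to `ℤ`. -/
noncomputable def extTransfer (u : Gen n → Rˣ) (k : ℤ) : Matrix (Fin 3) (Fin 3) R[T;T⁻¹] :=
  transfer (extX u k) (extY u k)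

/-- The monodromy around the annulus, starting at square `s`. -/
noncomputable def monodromy (u : Gen n → Rˣ) (s : ℤ) : Matrix (Fin 3) (Fin 3) R[T;T⁻¹] :=
  seqProd (fun k => extTransfer u (s + k)) n * Matrix.scalar (Fin 3) (endFactor n (u .Z : R))

theorem extX_add (u : Gen n → Rˣ) (k : ℤ) : extX u (k + n) = u .Z * extX u k * (u .Z)⁻¹ := by
  have hn : (n : ℤ) ≠ 0 := by exact_mod_cast NeZero.ne n
  rw [extX, extX, Int.add_ediv_of_dvd_right (dvd_refl _), Int.ediv_self hn, Int.add_emod_right,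
    add_comm, zpow_one_add]
  simp only [mul_inv_rev, mul_assoc]

theorem extY_add (u : Gen n → Rˣ) (k : ℤ) : extY u (k + n) = u .Z * extY u k * (u .Z)⁻¹ := by
  have hn : (n : ℤ) ≠ 0 := by exact_mod_cast NeZero.ne n
  rw [extY, extY, Int.add_ediv_of_dvd_right (dvd_refl _), Int.ediv_self hn, Int.add_emod_right,
    add_comm, zpow_one_add]
  simp only [mul_inv_rev, mul_assoc]

theorem extX_natCast (u : Gen n → Rˣ) (i : Fin n) : extX u ((i : ℕ) : ℤ) = u (.X i) := by
  have h0 : ((i : ℕ) : ℤ) / n = 0 := Int.ediv_eq_zero_of_lt (by omega) (by have := i.2; omega)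
  have h1 : ((i : ℕ) : ℤ) % n = i := Int.emod_eq_of_lt (by omega) (by have := i.2; omega)
  simp [extX, h0, h1]

theorem extY_natCast (u : Gen n → Rˣ) (i : Fin n) : extY u ((i : ℕ) : ℤ) = u (.Y i) := by
  have h0 : ((i : ℕ) : ℤ) / n = 0 := Int.ediv_eq_zero_of_lt (by omega) (by have := i.2; omega)
  have h1 : ((i : ℕ) : ℤ) % n = i := Int.emod_eq_of_lt (by omega) (by have := i.2; omega)
  simp [extY, h0, h1]

/-- A sequence that is quasi-periodic with monodromy `z` is determined by one period. -/
theorem eq_of_quasiPeriodic {G : Type*} [Group G] {z : G} {f g : ℤ → G}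
    (hf : ∀ k, f (k + n) = z * f k * z⁻¹) (hg : ∀ k, g (k + n) = z * g k * z⁻¹)
    (h : ∀ i : Fin n, f ((i : ℕ) : ℤ) = g ((i : ℕ) : ℤ)) (k : ℤ) : f k = g k := by
  have hn : (n : ℤ) ≠ 0 := by exact_mod_cast NeZero.ne n
  have step (k : ℤ) : f (k + n) = g (k + n) ↔ f k = g k := by
    rw [hf, hg]; simp
  have steps (q : ℤ) (k : ℤ) : f (k + q * n) = g (k + q * n) ↔ f k = g k := by
    induction q using Int.induction_on with
    | zero => simp
    | succ q ih => rw [← ih, ← step (k + q * n)]; ring_nf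
    | pred q ih => rw [← ih, ← step (k + (-q - 1) * n)]; ring_nf
  rw [← Int.emod_add_mul_ediv k n, mul_comm, steps]
  have h0 := Int.emod_nonneg k hn
  have h1 := Int.emod_lt_of_pos k (by omega : (0 : ℤ) < n)
  have := h ⟨(k % n).toNat, by omega⟩
  simpa [Int.toNat_of_nonneg h0] using this

theorem C_conj_mul_endFactor (m : ℕ) (z : Rˣ) (w : R) :
    (.C (z * w * (z⁻¹ : Rˣ)) : R[T;T⁻¹]) * endFactor m (z : R) = endFactor m (z : R) * .C w := by
  rw [endFactor, mul_assoc _ (LaurentPolynomial.T _), LaurentPolynomial.T_mul, ← mul_assoc,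
    ← mul_assoc, ← map_mul, ← map_mul, mul_assoc, Units.inv_mul, mul_one]

/-- The scalar matrix is not central, because its entry contains z. Moving it past a transfer matrix
undoes the conjugation of the weights by z. -/
theorem scalar_mul_transfer {x y x' y' : R} {z : Rˣ} (hx : x' = z * x * (z⁻¹ : Rˣ))
    (hy : y' = z * y * (z⁻¹ : Rˣ)) (n : ℕ) :
    transfer x' y' * Matrix.scalar (Fin 3) (endFactor n (z : R)) =
      Matrix.scalar (Fin 3) (endFactor n (z : R)) * transfer x y := by
  have h := C_conj_mul_endFactor n z
  have hz : z * x * (z⁻¹ : Rˣ) + z * y * (z⁻¹ : Rˣ) = z * (x + y) * (z⁻¹ : Rˣ) := by noncomm_ring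
  subst hx hy
  refine Matrix.ext fun i j => ?_
  fin_cases i <;> fin_cases j <;>
    simp [transfer, -map_add, -map_mul, hz, h, LaurentPolynomial.T_mul]
  rw [mul_assoc, LaurentPolynomial.T_mul, ← mul_assoc, h, mul_assoc]

theorem extTransfer_add_mul (u : Gen n → Rˣ) (k : ℤ) :
    extTransfer u (k + n) * Matrix.scalar (Fin 3) (endFactor n (u .Z : R)) =
      Matrix.scalar (Fin 3) (endFactor n (u .Z : R)) * extTransfer u k :=
  scalar_mul_transfer (by simp [extX_add]) (by simp [extY_add]) n

/-- Moving the base point by one square takes the first factor L_s to the end: the new last factor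
L_{s+n} becomes L_s on passing ζ. The two monodromies thus have the forms AB and BA. -/
theorem cyc_monodromy_succ [Algebra ℚ R] (u : Gen n → Rˣ) (s : ℤ) (i : ℕ) (j : ℤ) :
    cyc ((monodromy u (s + 1) ^ i).trace.coeff j) = cyc ((monodromy u s ^ i).trace.coeff j) := by
  obtain ⟨m, hm⟩ := Nat.exists_eq_succ_of_ne_zero (NeZero.ne n)
  have hs (f : ℕ → Matrix (Fin 3) (Fin 3) R[T;T⁻¹]) : seqProd f n = seqProd f (m + 1) :=
    congrArg (seqProd f) hm
  have h0 : monodromy u s = extTransfer u s * (seqProd (fun k => extTransfer u (s + 1 + k)) m *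
      Matrix.scalar (Fin 3) (endFactor n (u .Z : R))) := by
    rw [monodromy, hs, seqProd_succ', mul_assoc]
    simp only [Nat.cast_add, Nat.cast_one, Nat.cast_zero, add_zero, add_assoc, add_comm (1 : ℤ)]
  have h1 : monodromy u (s + 1) = seqProd (fun k => extTransfer u (s + 1 + k)) m *
      Matrix.scalar (Fin 3) (endFactor n (u .Z : R)) * extTransfer u s := by
    rw [monodromy, mul_assoc _ _ (extTransfer u s), ← extTransfer_add_mul]
    have : s + (n : ℤ) = s + 1 + (m : ℕ) := by rw [hm]; push_cast; ring
    rw [this, ← mul_assoc, hs, seqProd_succ]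
  rw [h0, h1, cyc_coeff_trace_pow_mul_comm]

end Transfer

/-! ### Invariance of the monodromy traces -/

section Invariance

variable {n : ℕ} [NeZero n] {R : Type*} [Ring R]

theorem val_sigmaUnit {u : Gen n → Rˣ} (hu : IsGeneric u) (k : ℤ) :
    (sigmaUnit hu k : R) = extX u k + extY u k := rfl

theorem sigmaUnit_add {u : Gen n → Rˣ} (hu : IsGeneric u) (k : ℤ) :
    sigmaUnit hu (k + n) = u .Z * sigmaUnit hu k * (u .Z)⁻¹ := by
  ext
  simp only [val_sigmaUnit, extX_add, extY_add, Units.val_mul]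
  noncomm_ring

/-- The pentagram map fixes Z, so both sides are quasi-periodic with the same Z, and they agree by
definition on one period. -/
theorem extX_pentagram {u : Gen n → Rˣ} (hu : IsGeneric u) (k : ℤ) :
    extX (pentagram u hu) k = (sigmaUnit hu k)⁻¹ * extX u k * sigmaUnit hu (k + 2) := by
  refine eq_of_quasiPeriodic (n := n) (z := u .Z) (extX_add (pentagram u hu))
    (g := fun k => (sigmaUnit hu k)⁻¹ * extX u k * sigmaUnit hu (k + 2)) (fun k => ?_)
    (fun i => ?_) k
  · simp only [sigmaUnit_add, extX_add, add_right_comm k (n : ℤ) 2]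
    group
  · rw [extX_natCast, pentagram]

theorem extY_pentagram {u : Gen n → Rˣ} (hu : IsGeneric u) (k : ℤ) :
    extY (pentagram u hu) k = (sigmaUnit hu (k + 1))⁻¹ * extY u (k + 1) * sigmaUnit hu (k + 3) := by
  refine eq_of_quasiPeriodic (n := n) (z := u .Z) (extY_add (pentagram u hu))
    (g := fun k => (sigmaUnit hu (k + 1))⁻¹ * extY u (k + 1) * sigmaUnit hu (k + 3)) (fun k => ?_)
    (fun i => ?_) k
  · simp only [sigmaUnit_add, extY_add, add_right_comm k (n : ℤ) _]
    group
  · rw [extY_natCast, pentagram]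

theorem extX_shift (u : Gen n → Rˣ) (k : ℤ) : extX (shift u) k = extX u (k - 1) := by
  refine eq_of_quasiPeriodic (n := n) (z := u .Z) (extX_add (shift u))
    (g := fun k => extX u (k - 1)) (fun k => ?_) (fun i => ?_) k
  · rw [add_sub_right_comm, extX_add]
  · rw [extX_natCast, shift]

theorem extY_shift (u : Gen n → Rˣ) (k : ℤ) : extY (shift u) k = extY u (k - 1) := by
  refine eq_of_quasiPeriodic (n := n) (z := u .Z) (extY_add (shift u))
    (g := fun k => extY u (k - 1)) (fun k => ?_) (fun i => ?_) k
  · rw [add_sub_right_comm, extY_add]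
  · rw [extY_natCast, shift]

theorem monodromy_shift (u : Gen n → Rˣ) (s : ℤ) :
    monodromy (shift u) (s + 1) = monodromy u s := by
  have h (k : ℤ) : extTransfer (shift u) (s + 1 + k) = extTransfer u (s + k) := by
    rw [extTransfer, extX_shift, extY_shift, add_right_comm, add_sub_cancel_right, extTransfer]
  simp only [monodromy, h]
  rfl

theorem cyc_monodromy_shift [Algebra ℚ R] (u : Gen n → Rˣ) (s : ℤ) (i : ℕ) (j : ℤ) :
    cyc ((monodromy (shift u) s ^ i).trace.coeff j) = cyc ((monodromy u s ^ i).trace.coeff j) := by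
  rw [← cyc_monodromy_succ, monodromy_shift]

/-- The shape of the matrices that express solutions of the linear problem for the image under
the pentagram map through solutions of the original linear problem. -/
noncomputable def intertwinerMatrix (a b c d : R) : Matrix (Fin 3) (Fin 3) R[T;T⁻¹] :=
  !![0, .C a, 0; 0, .C c, .C b; .T 1, -(.T 1 * .C a), .C d]

/-- Here x, y belong to square k + 2, x', y' to square k of the image, and the primed a, b, c, d to
the intertwiner at k + 1. The substitution T enters only through x' = c σ and y' a' = b, with σ = x
+ y; the rest is a σ = σ a = 1 and the index shift c' = d. -/
theorem transfer_mul_intertwinerMatrix {x y x' y' a b c a' b' c' d d' : R}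
    (ha : a * (x + y) = 1) (ha' : (x + y) * a = 1) (hd' : d' = a * x) (hb' : b' = a * y)
    (hc' : c' = d) (hx : x' = c * (x + y)) (hy : y' * a' = b) :
    transfer x' y' * intertwinerMatrix a' b' c' d' = intertwinerMatrix a b c d * transfer x y := by
  have hxd : x' * d' = c * x := by
    rw [hx, hd', mul_assoc, ← mul_assoc _ a, ha', one_mul]
  have hTT : (.T (-1) * .T 1 : R[T;T⁻¹]) = 1 := by rw [← LaurentPolynomial.T_add]; rfl
  have hT := LaurentPolynomial.T_mul (R := R) (-1)
  have hT1 := LaurentPolynomial.T_mul (R := R) 1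
  rw [transfer, transfer, intertwinerMatrix, intertwinerMatrix]
  -- From here λ⁻¹ and λ are opaque elements r and t, known only to be central with r t = 1.
  generalize (.T (-1) : R[T;T⁻¹]) = r at *
  generalize (.T 1 : R[T;T⁻¹]) = t at *
  have hrt (f : R[T;T⁻¹]) : r * (t * f) = f := by rw [← mul_assoc, hTT, one_mul]
  have htr (f : R[T;T⁻¹]) : t * (f * r) = f := by rw [hT1, mul_assoc, hTT, mul_one]
  refine Matrix.ext fun i j => ?_
  fin_cases i <;> fin_cases j <;>
    simp [Matrix.mul_apply, Fin.sum_univ_three, -map_add, -map_mul, mul_assoc, hrt, hTT]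
  · rw [← map_mul, ha, map_one]
  · rw [hT, hd', map_mul, mul_assoc]
  · rw [hx, map_mul]
  · rw [← hy, map_mul, map_add, add_mul]; abel
  · rw [hT, ← mul_assoc, ← mul_assoc, ← map_mul, ← map_mul, hxd]
  · rw [← map_mul, ha, map_one, mul_one, add_neg_cancel]
  · rw [hc']
  -- The last entry is the identity 1 - a x = a y, that is, a (x + y) = 1.
  · rw [← mul_assoc (LaurentPolynomial.C a), htr, hT1, hTT, ← map_mul, hb', ← map_one (LaurentPolynomial.C (R := R)),
      ← ha, ← map_neg, ← map_add]
    congr 1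
    noncomm_ring

/-- The matrix that expresses solutions of the linear problem for the image under the pentagram
map through solutions of the original linear problem. -/
noncomputable def intertwiner (u : Gen n → Rˣ) (hu : IsGeneric u) (k : ℤ) :
    Matrix (Fin 3) (Fin 3) R[T;T⁻¹] :=
  intertwinerMatrix ((sigmaUnit hu (k + 2))⁻¹ : Rˣ)
    ((sigmaUnit hu (k + 1))⁻¹ * extY u (k + 1) : Rˣ) ((sigmaUnit hu k)⁻¹ * extX u k : Rˣ)
    ((sigmaUnit hu (k + 1))⁻¹ * extX u (k + 1) : Rˣ)

/-- Moving the first column to the end makes the matrix lower triangular with diagonal a, b, t, all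
units. Forward substitution then gives the inverse without any determinant. -/
theorem exists_inverse_matrix {S : Type*} [Ring S] (a b t : Sˣ) (c d : S) :
    ∃ Q : Matrix (Fin 3) (Fin 3) S, !![0, a.1, 0; 0, c, b.1; t.1, -(t.1 * a.1), d] * Q = 1 ∧
      Q * !![0, a.1, 0; 0, c, b.1; t.1, -(t.1 * a.1), d] = 1 := by
  refine ⟨!![1 + t⁻¹.1 * d * b⁻¹.1 * c * a⁻¹.1, -(t⁻¹.1 * d * b⁻¹.1), t⁻¹.1; a⁻¹.1, 0, 0;
    -(b⁻¹.1 * c * a⁻¹.1), b⁻¹.1, 0], ?_, ?_⟩ <;>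
  · refine Matrix.ext fun i j => ?_
    fin_cases i <;> fin_cases j <;>
      simp [Matrix.mul_apply, Fin.sum_univ_three, mul_assoc, mul_add, add_mul]

theorem exists_inverse_intertwiner {u : Gen n → Rˣ} (hu : IsGeneric u) (k : ℤ) :
    ∃ Q, intertwiner u hu k * Q = 1 ∧ Q * intertwiner u hu k = 1 :=
  exists_inverse_matrix (Units.map (LaurentPolynomial.C : R →+* R[T;T⁻¹]).toMonoidHom
      (sigmaUnit hu (k + 2))⁻¹)
    (Units.map (LaurentPolynomial.C : R →+* R[T;T⁻¹]).toMonoidHom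
      ((sigmaUnit hu (k + 1))⁻¹ * extY u (k + 1)))
    (show (R[T;T⁻¹])ˣ from (LaurentPolynomial.isUnit_T 1).unit) _ _

theorem extTransfer_pentagram_mul {u : Gen n → Rˣ} (hu : IsGeneric u) (k : ℤ) :
    extTransfer (pentagram u hu) k * intertwiner u hu (k + 1) =
      intertwiner u hu k * extTransfer u (k + 2) := by
  have e1 : k + 1 + 1 = k + 2 := by ring
  have e2 : k + 1 + 2 = k + 3 := by ring
  rw [intertwiner, intertwiner, e1, e2]
  refine transfer_mul_intertwinerMatrix ?_ ?_ ?_ ?_ ?_ ?_ ?_ <;>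
    simp [extX_pentagram, extY_pentagram, ← val_sigmaUnit hu]

theorem intertwinerMatrix_mul_scalar (z : Rˣ) (m : ℕ) (a b c d : R) :
    intertwinerMatrix (z * a * (z⁻¹ : Rˣ)) (z * b * (z⁻¹ : Rˣ)) (z * c * (z⁻¹ : Rˣ))
        (z * d * (z⁻¹ : Rˣ)) * Matrix.scalar (Fin 3) (endFactor m (z : R)) =
      Matrix.scalar (Fin 3) (endFactor m (z : R)) * intertwinerMatrix a b c d := by
  have h := C_conj_mul_endFactor m z
  have hT1 := LaurentPolynomial.T_mul (R := R) 1
  rw [intertwinerMatrix, intertwinerMatrix]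
  generalize (.T 1 : R[T;T⁻¹]) = t at *
  refine Matrix.ext fun i j => ?_
  fin_cases i <;> fin_cases j <;>
    simp [-map_add, -map_mul, hT1, h]
  rw [← mul_assoc, ← h, mul_assoc _ t, hT1, ← mul_assoc]

theorem intertwiner_add_mul_scalar {u : Gen n → Rˣ} (hu : IsGeneric u) (k : ℤ) :
    intertwiner u hu (k + n) * Matrix.scalar (Fin 3) (endFactor n (u .Z : R)) =
      Matrix.scalar (Fin 3) (endFactor n (u .Z : R)) * intertwiner u hu k := by
  rw [intertwiner, intertwiner, ← intertwinerMatrix_mul_scalar]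
  congr 2 <;>
  · rw [← Units.val_mul, ← Units.val_mul]
    congr 1
    simp only [add_right_comm k (n : ℤ) _, sigmaUnit_add, extX_add, extY_add]
    group

theorem cyc_monodromy_pentagram [Algebra ℚ R] {u : Gen n → Rˣ} (hu : IsGeneric u) (i : ℕ) (j : ℤ) :
    cyc ((monodromy (pentagram u hu) 0 ^ i).trace.coeff j) =
      cyc ((monodromy u 0 ^ i).trace.coeff j) := by
  obtain ⟨Q, h1, h2⟩ := exists_inverse_intertwiner hu 0
  -- The base point 2 on the right comes from the index shift in L'_k P_{k+1} = P_k L_{k+2}; writing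
  -- it as 0 + 1 + 1 lets `cyc_monodromy_succ` bring it back to 0.
  have h : monodromy (pentagram u hu) 0 * intertwiner u hu 0 =
      intertwiner u hu 0 * monodromy u (0 + 1 + 1) := by
    have := seqProd_mul_eq (p := fun k : ℕ => intertwiner u hu k)
      (f := fun k : ℕ => extTransfer (pentagram u hu) (0 + k))
      (g := fun k : ℕ => extTransfer u (0 + 1 + 1 + k)) (fun k => by
        simpa [add_comm (k : ℤ)] using extTransfer_pentagram_mul hu k) n
    rw [monodromy, mul_assoc]
    -- The end factor of the image is the original one, since T fixes Z. It turns P_0 into P_n,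
    -- which is where the telescoping starts.
    change _ * (Matrix.scalar (Fin 3) (endFactor n (u .Z : R)) * _) = _
    rw [← intertwiner_add_mul_scalar, zero_add, ← mul_assoc, this, mul_assoc]
    rfl
  rw [cyc_coeff_trace_pow_eq_of_mul_eq h h1 h2, cyc_monodromy_succ, cyc_monodromy_succ]

end Invariance

/-! ### Path sums in the network -/

section Network

variable {n : ℕ}

/-- The sum of the weights of all paths between two vertices of the network. -/
noncomputable def pathSum (a w : Vertex n) : (LoopAlg n)[T;T⁻¹] :=
  ∑ᶠ p : Quiver.Path a w,
    p.weight fun {a b} (e : {e : Arrow n // e.src = a ∧ e.tgt = b}) => e.1.modifiedWeight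

/-- A path between distinct vertices has a last arrow. -/
def pathEquivSigma {a w : Vertex n} (h : a ≠ w) :
    Quiver.Path a w ≃ Σ e : {e : Arrow n // e.tgt = w}, Quiver.Path a e.1.src where
  toFun p := match w, p, h with
    | _, .nil, h => (h rfl).elim
    | _, .cons p ⟨e, h₁, h₂⟩, _ => ⟨⟨e, h₂⟩, h₁ ▸ p⟩
  invFun q := q.2.cons ⟨q.1.1, rfl, q.1.2⟩
  left_inv p := by
    cases p with
    | nil => exact (h rfl).elim
    | cons p e =>
      obtain ⟨e, rfl, rfl⟩ := e
      rfl
  right_inv q := rfl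

/-- Splitting off the last arrow gives the recursion that determines all path sums from those at the
sources. -/
theorem pathSum_of_ne {a w : Vertex n} (h : a ≠ w) :
    pathSum a w = ∑ᶠ e ∈ {e : Arrow n | e.tgt = w}, pathSum a e.src * e.modifiedWeight := by
  classical
  have : Fintype (Arrow n) := Fintype.ofFinite _
  have (w : Vertex n) : Fintype (Quiver.Path a w) := Fintype.ofFinite _
  have e := finsum_set_coe_eq_finsum_mem (f := fun e => pathSum a e.src * e.modifiedWeight)
    {e : Arrow n | e.tgt = w}
  rw [← e]
  change _ = ∑ᶠ e : {e : Arrow n // e.tgt = w}, _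
  simp only [pathSum, finsum_eq_sum_of_fintype, Finset.sum_mul]
  rw [← (pathEquivSigma h).symm.sum_comp, Fintype.sum_sigma]
  exact Finset.sum_congr rfl fun e _ => Finset.sum_congr rfl fun p _ =>
    Quiver.Path.weight_cons _ _ _

theorem pathSum_source (a b : Fin 3) :
    pathSum (.source a : Vertex n) (.source b) = if a = b then 1 else 0 := by
  have hs (e : Arrow n) : e.tgt ≠ .source b := by
    intro h
    have := e.rank_lt
    rw [h] at this
    exact absurd this (Nat.not_lt_zero _)
  split_ifs with h
  · subst h
    have hp (p : Quiver.Path (.source a : Vertex n) (.source a)) : p = .nil := by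
      cases p with
      | nil => rfl
      | cons p e => exact (hs e.1 e.2.2).elim
    rw [pathSum, finsum_eq_single _ .nil fun p h => (h (hp p)).elim]
    exact Quiver.Path.weight_nil _ _
  · rw [pathSum_of_ne (by simpa using h)]
    refine finsum_mem_eq_zero_of_forall_eq_zero fun e he => (hs e he).elim

theorem botPort_of_lt {k : ℕ} (h : k < n) : botPort n k = .botLeft ⟨k, h⟩ := dif_pos h

theorem Arrow.tgt_eq_topRight_iff (e : Arrow n) (i : Fin n) : e.tgt = .topRight i ↔ e = .top i := by
  cases e <;> simp only [Arrow.tgt, topPort, botPort] <;> (try split_ifs) <;> simp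

theorem Arrow.tgt_eq_botRight_iff (e : Arrow n) (i : Fin n) :
    e.tgt = .botRight i ↔ e = .bottom i ∨ e = .right i := by
  cases e <;> simp only [Arrow.tgt, topPort, botPort] <;> (try split_ifs) <;> simp

theorem Arrow.tgt_eq_topLeft_zero_iff (e : Arrow n) (hn : 0 < n) :
    e.tgt = .topLeft ⟨0, hn⟩ ↔ e = .entry 0 ∨ e = .left ⟨0, hn⟩ := by
  cases e <;> simp only [Arrow.tgt, topPort, botPort] <;> (try split_ifs) <;>
    simp [*]

theorem Arrow.tgt_eq_topLeft_succ_iff (e : Arrow n) (k : ℕ) (hk : k + 1 < n) :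
    e.tgt = .topLeft ⟨k + 1, hk⟩ ↔ e = .down ⟨k, by omega⟩ ∨ e = .left ⟨k + 1, hk⟩ := by
  cases e <;> simp only [Arrow.tgt, topPort, botPort] <;> (try split_ifs) <;>
    simp [Fin.ext_iff] <;> omega

theorem Arrow.tgt_eq_sink_zero_iff (e : Arrow n) (k : ℕ) (hk : k + 1 = n) :
    e.tgt = .sink 0 ↔ e = .down ⟨k, by omega⟩ := by
  cases e <;> simp only [Arrow.tgt, topPort, botPort] <;> (try split_ifs) <;>
    simp [Fin.ext_iff] <;> omega

theorem Arrow.tgt_eq_botPort_zero_iff (e : Arrow n) (hn : 0 < n) :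
    e.tgt = botPort n 0 ↔ e = .entry 1 := by
  cases e <;> simp only [Arrow.tgt, topPort, botPort] <;> (try split_ifs) <;>
    simp [*]

theorem Arrow.tgt_eq_botPort_one_iff (e : Arrow n) (hn : 0 < n) :
    e.tgt = botPort n 1 ↔ e = .entry 2 := by
  cases e <;> simp only [Arrow.tgt, topPort, botPort] <;> (try split_ifs) <;>
    simp [*] <;> omega

theorem Arrow.tgt_eq_botPort_add_two_iff (e : Arrow n) (k : ℕ) (hk : k < n) :
    e.tgt = botPort n (k + 2) ↔ e = .skip ⟨k, hk⟩ := by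
  cases e <;> simp only [Arrow.tgt, topPort, botPort] <;> (try split_ifs) <;>
    simp [Fin.ext_iff] <;> omega

theorem pathSum_of_tgt_eq_iff {a w : Vertex n} (h : a ≠ w) {e₁ : Arrow n}
    (he : ∀ e : Arrow n, e.tgt = w ↔ e = e₁) : pathSum a w = pathSum a e₁.src * e₁.modifiedWeight := by
  have : {e : Arrow n | e.tgt = w} = {e₁} := Set.ext he
  rw [pathSum_of_ne h, this, finsum_mem_singleton]

theorem pathSum_of_tgt_eq_iff_or {a w : Vertex n} (h : a ≠ w) {e₁ e₂ : Arrow n} (hne : e₁ ≠ e₂)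
    (he : ∀ e : Arrow n, e.tgt = w ↔ e = e₁ ∨ e = e₂) :
    pathSum a w =
      pathSum a e₁.src * e₁.modifiedWeight + pathSum a e₂.src * e₂.modifiedWeight := by
  have : {e : Arrow n | e.tgt = w} = {e₁, e₂} := Set.ext he
  rw [pathSum_of_ne h, this, finsum_mem_pair hne]

/-- The factor that the weights along a path to the entrance of square `k`, or to the sink in
place of it, contain beyond the transfer matrices. -/
noncomputable def portFactor (n k : ℕ) : (LoopAlg n)[T;T⁻¹] :=
  if k < n then .T ((k + 1) / 3) else endFactor n (loop .Z)

/-- The floor of (k + 1) / 3 jumps exactly when the downward arrow crosses the cut, so after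
rescaling these arrows carry no λ. -/
theorem portFactor_mul_down (k : Fin n) :
    portFactor n k * (Arrow.down k).modifiedWeight = portFactor n (k + 1) := by
  have hk := k.2
  rw [portFactor, if_pos hk, portFactor, Arrow.modifiedWeight]
  split_ifs with h
  · simp only [Arrow.weight, Arrow.crossing, Arrow.tgt, topPort, h, dif_pos, and_true, mul_one,
      map_one, one_mul, add_zero, ← LaurentPolynomial.T_add]
    congr 1
    split_ifs <;> omega
  · simp only [Arrow.weight, Arrow.crossing, Arrow.tgt, topPort, h, dif_neg, and_false, one_mul,
      not_false_eq_true, if_false, zero_add, endFactor]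
    rw [LaurentPolynomial.T_mul, LaurentPolynomial.mul_T_assoc]
    congr 2
    simp only [Fin.val_zero]
    -- The crossings in the collar at the sinks depend on n modulo 3; in each case they raise the
    -- exponent to ⌊(n + 2)/3⌋.
    obtain h3 | h3 | h3 : n % 3 = 0 ∨ n % 3 = 1 ∨ n % 3 = 2 := by omega
    all_goals split_ifs <;> omega

/-- After rescaling, every skip arrow carries λ⁻¹, whether or not it crosses the cut itself. -/
theorem portFactor_mul_skip (k : Fin n) :
    portFactor n k * (Arrow.skip k).modifiedWeight = .T (-1) * portFactor n (k + 2) := by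
  have hk := k.2
  rw [portFactor, if_pos hk, portFactor, Arrow.modifiedWeight]
  split_ifs with h
  · simp only [Arrow.weight, Arrow.crossing, Arrow.tgt, botPort, h, dif_pos, mul_one,
      map_one, one_mul, add_zero, ← LaurentPolynomial.T_add]
    congr 1
    split_ifs <;> omega
  · simp only [Arrow.weight, Arrow.crossing, Arrow.tgt, botPort, h, dif_neg, one_mul,
      not_false_eq_true, endFactor]
    rw [LaurentPolynomial.T_mul, LaurentPolynomial.T_mul (-1), LaurentPolynomial.mul_T_assoc,
      LaurentPolynomial.mul_T_assoc]
    have h3 : n % 3 = 0 ∨ n % 3 = 1 ∨ n % 3 = 2 := by omega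
    split_ifs with h1 <;> congr 2 <;> push_cast <;>
      rcases h3 with h3 | h3 | h3 <;> split_ifs <;> omega

/-- The transfer matrices of the network itself. -/
noncomputable def genTransfer (n : ℕ) [NeZero n] (k : ℕ) :
    Matrix (Fin 3) (Fin 3) (LoopAlg n)[T;T⁻¹] :=
  transfer (loop (.X (Fin.ofNat n k))) (loop (.Y (Fin.ofNat n k)))

theorem pathSum_botPort_zero (a : Fin 3) (hn : 0 < n) :
    pathSum (.source a) (botPort n 0) = (if a = 1 then 1 else 0) * portFactor n 0 := by
  rw [pathSum_of_tgt_eq_iff (by simp [botPort, hn]) fun e => e.tgt_eq_botPort_zero_iff hn]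
  simp [Arrow.src, pathSum_source, portFactor, hn, Arrow.modifiedWeight, Arrow.weight,
    Arrow.crossing, Arrow.tgt, botPort]

theorem pathSum_botPort_one (a : Fin 3) (hn : 0 < n) :
    pathSum (.source a) (botPort n 1) = (if a = 2 then 1 else 0) * portFactor n 1 := by
  rw [pathSum_of_tgt_eq_iff (by simp only [botPort]; split_ifs <;> simp)
    fun e => e.tgt_eq_botPort_one_iff hn]
  by_cases h : 1 < n
  · simp [Arrow.src, pathSum_source, portFactor, h, Arrow.modifiedWeight, Arrow.weight,
      Arrow.crossing, Arrow.tgt, botPort]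
  -- With a single square there is no second lower left corner: source 3 is joined directly to sink
  -- 2, and this arrow carries the whole end factor.
  · obtain rfl : n = 1 := by omega
    simp [Arrow.src, pathSum_source, portFactor, Arrow.modifiedWeight, Arrow.weight,
      Arrow.crossing, Arrow.tgt, botPort, endFactor]

theorem modifiedWeight_top (k : Fin n) : (Arrow.top k).modifiedWeight = 1 := by
  simp [Arrow.modifiedWeight, Arrow.weight, Arrow.crossing, Arrow.tgt]

theorem modifiedWeight_right (k : Fin n) : (Arrow.right k).modifiedWeight = 1 := by
  simp [Arrow.modifiedWeight, Arrow.weight, Arrow.crossing, Arrow.tgt]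

theorem modifiedWeight_left (k : Fin n) : (Arrow.left k).modifiedWeight = .C (loop (.X k)) := by
  simp [Arrow.modifiedWeight, Arrow.weight, Arrow.crossing, Arrow.tgt]

theorem modifiedWeight_bottom (k : Fin n) :
    (Arrow.bottom k).modifiedWeight = .C (loop (.Y k)) := by
  simp [Arrow.modifiedWeight, Arrow.weight, Arrow.crossing, Arrow.tgt]

theorem pathSum_topRight (a : Fin 3) (k : Fin n) :
    pathSum (.source a) (.topRight k) = pathSum (.source a) (.topLeft k) := by
  rw [pathSum_of_tgt_eq_iff (by simp) fun e => e.tgt_eq_topRight_iff k, modifiedWeight_top, mul_one]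
  rfl

theorem pathSum_botRight (a : Fin 3) (k : Fin n) :
    pathSum (.source a) (.botRight k) =
      pathSum (.source a) (.botLeft k) * .C (loop (.Y k)) + pathSum (.source a) (.topLeft k) := by
  rw [pathSum_of_tgt_eq_iff_or (by simp) (by simp) fun e => e.tgt_eq_botRight_iff k,
    modifiedWeight_right, modifiedWeight_bottom, mul_one, ← pathSum_topRight]
  rfl

theorem pathSum_botPort_add_two (a : Fin 3) (k : Fin n) :
    pathSum (.source a) (botPort n (k + 2)) =
      pathSum (.source a) (.topLeft k) * (Arrow.skip k).modifiedWeight := by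
  rw [pathSum_of_tgt_eq_iff (by simp only [botPort]; split_ifs <;> simp)
    fun e => e.tgt_eq_botPort_add_two_iff k k.2, ← pathSum_topRight]
  rfl

theorem seqProd_congr {M : Type*} [Monoid M] {f g : ℕ → M} {m : ℕ} (h : ∀ k < m, f k = g k) :
    seqProd f m = seqProd g m := by
  rw [seqProd, seqProd, List.map_congr_left fun k hk => h k (List.mem_range.1 hk)]

/-- The boundary measurements of the first `k` squares. -/
noncomputable def partialProd (n : ℕ) [NeZero n] (k : ℕ) :
    Matrix (Fin 3) (Fin 3) (LoopAlg n)[T;T⁻¹] :=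
  seqProd (genTransfer n) k

theorem partialProd_succ_apply [NeZero n] (a : Fin 3) (k : Fin n) :
    partialProd n (k + 1) a 0 =
        partialProd n k a 0 + partialProd n k a 1 * (.C (loop (.X k)) + .C (loop (.Y k))) ∧
      partialProd n (k + 1) a 1 = partialProd n k a 2 ∧
      partialProd n (k + 1) a 2 =
        (partialProd n k a 0 + partialProd n k a 1 * .C (loop (.X k))) * .T (-1) := by
  have hk : Fin.ofNat n k = k := Fin.ext (Nat.mod_eq_of_lt k.2)
  simp only [partialProd, seqProd_succ, genTransfer, transfer, hk]
  generalize (.T (-1) : (LoopAlg n)[T;T⁻¹]) = t at *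
  refine ⟨?_, ?_, ?_⟩ <;> simp [Matrix.mul_apply, Fin.sum_univ_three, mul_assoc, add_mul]

theorem portFactor_comm {k : ℕ} (hk : k < n) (f : (LoopAlg n)[T;T⁻¹]) :
    portFactor n k * f = f * portFactor n k := by
  rw [portFactor, if_pos hk, LaurentPolynomial.T_mul]

/-- Induction along the annulus, following the three ports in front of square k. An upper left
corner also receives the left arrow of its own square, whence the X term; at k = n the ports are the
sinks. -/
theorem pathSum_ports [NeZero n] (a : Fin 3) (k : ℕ) (hk : k ≤ n) :
    (∀ h : k < n, pathSum (.source a) (.topLeft ⟨k, h⟩) =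
      (partialProd n k a 0 + partialProd n k a 1 * .C (loop (.X ⟨k, h⟩))) * portFactor n k) ∧
    (k = n → pathSum (.source a : Vertex n) (.sink 0) = partialProd n k a 0 * portFactor n k) ∧
    pathSum (.source a) (botPort n k) = partialProd n k a 1 * portFactor n k ∧
    pathSum (.source a) (botPort n (k + 1)) = partialProd n k a 2 * portFactor n (k + 1) := by
  have hn : 0 < n := Nat.pos_of_ne_zero (NeZero.ne n)
  induction k with
  | zero =>
    have h1 : pathSum (.source a) (botPort n 0) = partialProd n 0 a 1 * portFactor n 0 := by
      rw [pathSum_botPort_zero a hn]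
      rfl
    refine ⟨fun h => ?_, fun h => absurd h hn.ne, h1, ?_⟩
    · rw [pathSum_of_tgt_eq_iff_or (by simp) (by simp) fun e => e.tgt_eq_topLeft_zero_iff hn,
        modifiedWeight_left, add_mul]
      refine congrArg₂ (· + ·) ?_ ?_
      · have : portFactor n 0 = 1 := by simp [portFactor, hn]
        simp only [Arrow.src, pathSum_source, this, mul_one]
        simp [Arrow.modifiedWeight, Arrow.weight, Arrow.crossing, Arrow.tgt, topPort, hn,
          partialProd, seqProd_zero, Matrix.one_apply]
      · rw [mul_assoc, ← portFactor_comm hn, ← mul_assoc, ← h1]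
        exact congrArg (pathSum _ · * _) (botPort_of_lt hn).symm
    · rw [zero_add, pathSum_botPort_one a hn]
      rfl
  | succ k ih =>
    have hk' : k < n := hk
    obtain ⟨ih1, -, ih2, ih3⟩ := ih hk'.le
    have ht := ih1 hk'
    obtain ⟨e0, e1, e2⟩ := partialProd_succ_apply a ⟨k, hk'⟩
    dsimp only at e0 e1 e2
    have hb : pathSum (.source a) (botPort n (k + 1)) =
        partialProd n (k + 1) a 1 * portFactor n (k + 1) := by rw [ih3, e1]
    have hr : pathSum (.source a) (.botRight ⟨k, hk'⟩) =
        partialProd n (k + 1) a 0 * portFactor n k := by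
      have hl : (.botLeft ⟨k, hk'⟩ : Vertex n) = botPort n k := (botPort_of_lt hk').symm
      rw [pathSum_botRight, ht, hl, ih2, e0, mul_assoc, portFactor_comm hk', ← mul_assoc,
        ← add_mul, mul_add, add_comm, add_assoc]
    refine ⟨fun h => ?_, fun h => ?_, hb, ?_⟩
    · rw [pathSum_of_tgt_eq_iff_or (by simp) (by simp) fun e => e.tgt_eq_topLeft_succ_iff k h,
        modifiedWeight_left, add_mul]
      refine congrArg₂ (· + ·) ?_ ?_
      · rw [Arrow.src, hr, mul_assoc, portFactor_mul_down ⟨k, hk'⟩]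
      · rw [mul_assoc, ← portFactor_comm h, ← mul_assoc, ← hb]
        exact congrArg (pathSum _ · * _) (botPort_of_lt h).symm
    · rw [pathSum_of_tgt_eq_iff (by simp) fun e => e.tgt_eq_sink_zero_iff k h, Arrow.src, hr,
        mul_assoc, portFactor_mul_down ⟨k, hk'⟩]
    · rw [pathSum_botPort_add_two a ⟨k, hk'⟩, ht, mul_assoc, portFactor_mul_skip ⟨k, hk'⟩, e2,
        mul_assoc]

theorem boundaryMatrix_eq (n : ℕ) [NeZero n] :
    boundaryMatrix n =
      seqProd (genTransfer n) n * Matrix.scalar (Fin 3) (endFactor n (loop .Z)) := by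
  have hf (k : ℕ) (h : n ≤ k) : portFactor n k = endFactor n (loop .Z) := by
    rw [portFactor, if_neg h.not_gt]
  refine Matrix.ext fun a b => ?_
  obtain ⟨-, h0, h1, h2⟩ := pathSum_ports (n := n) a n le_rfl
  change pathSum (.source a) (.sink b) = _
  rw [Matrix.scalar_apply, Matrix.mul_diagonal]
  fin_cases b
  · simpa [hf, partialProd] using h0 rfl
  · simpa [hf, botPort, partialProd] using h1
  · simpa [hf, botPort, partialProd] using h2

theorem evalAt_loop {R : Type*} [Ring R] [Algebra ℚ R] (u : Gen n → Rˣ) (g : Gen n) :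
    evalAt u (loop g) = u g := by
  simp [evalAt, loop]

/-- Evaluation acts on λ-coefficients, hence on matrices over Laurent polynomials, and there it
sends the boundary matrix to the monodromy based at square 0. -/
theorem evalAt_invariantCoeff [NeZero n] {R : Type*} [Ring R] [Algebra ℚ R] (u : Gen n → Rˣ)
    (i : ℕ) (j : ℤ) :
    evalAt u (invariantCoeff n i j) = (monodromy u 0 ^ i).trace.coeff j := by
  let φ : (LoopAlg n)[T;T⁻¹] →+* R[T;T⁻¹] :=
    AddMonoidAlgebra.mapRingHom ℤ (evalAt u : LoopAlg n →ₐ[ℚ] R).toRingHom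
  have hC (g : Gen n) : φ (.C (loop g)) = .C (u g : R) := by
    rw [← evalAt_loop u]; exact AddMonoidAlgebra.mapRingHom_single ..
  have hT (k : ℤ) : φ (.T k) = .T k := by
    refine (AddMonoidAlgebra.mapRingHom_single ..).trans ?_
    rw [map_one]; rfl
  have hprod (f : ℕ → Matrix (Fin 3) (Fin 3) (LoopAlg n)[T;T⁻¹]) (m : ℕ) :
      φ.mapMatrix (seqProd f m) = seqProd (fun k => φ.mapMatrix (f k)) m := by
    induction m with
    | zero => simp [seqProd_zero]
    | succ m ih => rw [seqProd_succ, seqProd_succ, map_mul, ih]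
  have hgen (k : ℕ) (hk : k < n) : φ.mapMatrix (genTransfer n k) = extTransfer u (0 + k) := by
    have hk' : Fin.ofNat n k = ⟨k, hk⟩ := Fin.ext (Nat.mod_eq_of_lt hk)
    have hX := extX_natCast u ⟨k, hk⟩
    have hY := extY_natCast u ⟨k, hk⟩
    rw [zero_add, extTransfer, hX, hY, genTransfer, hk', transfer, transfer, map_add, map_add]
    refine Matrix.ext fun a b => ?_
    fin_cases a <;> fin_cases b <;> simp [hC, hT]
  have hB : φ.mapMatrix (boundaryMatrix n) = monodromy u 0 := by
    rw [boundaryMatrix_eq, map_mul, hprod, monodromy]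
    refine congrArg₂ (· * ·) (seqProd_congr hgen) ?_
    · refine Matrix.ext fun a b => ?_
      simp [Matrix.scalar_apply, Matrix.diagonal_apply, endFactor, apply_ite φ, hC, hT]
  have h := AddMonoidAlgebra.coeff_mapRingHom (evalAt u : LoopAlg n →ₐ[ℚ] R).toRingHom
    (boundaryMatrix n ^ i).trace j
  refine h.symm.trans ?_
  change (φ _).coeff j = _
  rw [← hB, ← map_pow, AddMonoidHom.map_trace φ]
  rfl

end Network

theorem cyc_evalAt_pentagram {n : ℕ} [NeZero n] {R : Type*} [Ring R] [Algebra ℚ R]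
    (u : Gen n → Rˣ) (hu : IsGeneric u) (i : ℕ) (j : ℤ) :
    cyc (evalAt (pentagram u hu) (invariantCoeff n i j)) = cyc (evalAt u (invariantCoeff n i j)) ∧
      cyc (evalAt (shiftedPentagram u hu) (invariantCoeff n i j)) =
        cyc (evalAt u (invariantCoeff n i j)) := by
  simp only [evalAt_invariantCoeff, shiftedPentagram, cyc_monodromy_shift,
    cyc_monodromy_pentagram, and_self]

end GrassmannPentagram

theorem theorem13 (n : ℕ) [NeZero n] (i : ℕ) (j : ℤ) :
    (cyc (evalAt (pentagram (skewVar n) (skewVar_isGeneric n)) (invariantCoeff n i j)) =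
        cyc (evalAt (skewVar n) (invariantCoeff n i j)) ∧
      cyc (evalAt (shiftedPentagram (skewVar n) (skewVar_isGeneric n)) (invariantCoeff n i j)) =
        cyc (evalAt (skewVar n) (invariantCoeff n i j))) ∧
    ∀ (R : Type*) [Ring R] [Algebra ℚ R] (u : Gen n → Rˣ) (hu : IsGeneric u),
      cyc (evalAt (pentagram u hu) (invariantCoeff n i j)) =
          cyc (evalAt u (invariantCoeff n i j)) ∧
        cyc (evalAt (shiftedPentagram u hu) (invariantCoeff n i j)) =
          cyc (evalAt u (invariantCoeff n i j)) := by
  exact ⟨cyc_evalAt_pentagram _ (skewVar_isGeneric n) i j,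
    fun R _ _ u hu => cyc_evalAt_pentagram u hu i j⟩
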